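/- **Theorem 6.1.** Every finitely generated metabelian group $G$ has finite iterational depth $s(G)$, that is, $1\le s(G)<\infty$; in other words, $G$ is bounded. Here a group is metabelian if it has an abelian normal subgroup $N$ with $G/N$ abelian. For $n\ge 1$, a word $w=w(x_1,\dots,x_n)$ (an element of the free group on $x_1,\dots,x_n$) and $d\ge 1$, the $d$-th Engel type iteration $w_{\circ d}$ of $w$ on the first variable is defined by $w_{\circ 1}=w$ and $$w_{\circ (d+1)}(x_1,\dots,x_n)=w\bigl(w_{\circ d}(x_1,\dots,x_n),x_2,\dots,x_n\bigr).$$ A group $G$ satisfies the Engel type iterated identity $w$ if for all $x_1,\dots,x_n\in G$ there is $d\ge 1$ with $w_{\circ d}(x_1,\dots,x_n)=e$ in $G$. In that case the iterational depth $s(w,G)$ is the infimum of all $D\in\{1,2,\dots\}\cup\{\infty\}$ such that for all $x_1,\dots,x_n\in G$ there is an integer $d$ with $1\le d\le D$ and $w_{\circ d}(x_1,\dots,x_n)=e$. The iterational depth $s(G)$ is the supremum of $s(w,G)$ over all non-trivial (that is, not equal to the identity of the free group) iterated identities $w$ of $G$, in any number $n\ge 1$ of variables, with $s(G)=-\infty$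 if $G$ satisfies no non-trivial iterated identity. The group $G$ is bounded if $1\le s(G)<\infty$. Thus the theorem says that $G$ satisfies a non-trivial iterated identity and that there is an integer $D$, depending only on $G$, such that $s(w,G)\le D$ for every iterated identity $w$ of $G$. -/

import Mathlib

/-- `w(g, x₂, …, xₙ)`: the verbal map of a word `w` in the letters `x 0, …, x n`, as a function of
the first letter, the other letters taking the values `x 1, …, x n` in `G`. The value `x 0` is
not used. -/
def verbalMap {G : Type*} [Group G] {n : ℕ} (w : FreeGroup (Fin (n + 1))) (x : Fin (n + 1) → G)
    (g : G) : G :=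
  FreeGroup.lift (Function.update x 0 g) w

/-- The value at `x` of the `d`-th Engel type iteration of the word `w` on its first letter:
`w(w(… w(x 0, x 1, …, x n) …, x 1, …, x n), x 1, …, x n)`, with `d` occurrences of `w`. -/
def engelIter {G : Type*} [Group G] {n : ℕ} (w : FreeGroup (Fin (n + 1))) (d : ℕ)
    (x : Fin (n + 1) → G) : G :=
  (verbalMap w x)^[d] (x 0)

/-- `G` satisfies the Engel type iterated identity `w`. -/
def IsIteratedIdentity (G : Type*) [Group G] {n : ℕ} (w : FreeGroup (Fin (n + 1))) : Prop :=
  ∀ x : Fin (n + 1) → G, ∃ d : ℕ, 1 ≤ d ∧ engelIter w d x = 1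

/-- `G` has iterational depth at most `D` with respect to `w`. -/
def HasDepthAtMost (G : Type*) [Group G] {n : ℕ} (w : FreeGroup (Fin (n + 1))) (D : ℕ∞) : Prop :=
  ∀ x : Fin (n + 1) → G, ∃ d : ℕ, 1 ≤ d ∧ (d : ℕ∞) ≤ D ∧ engelIter w d x = 1

/-- The iterational depth `s(w, G)` of an iterated identity `w` in `G`
(`⊤` means that no finite number of iterations suffices for all tuples). -/
noncomputable def wordDepth (G : Type*) [Group G] {n : ℕ} (w : FreeGroup (Fin (n + 1))) : ℕ∞ :=
  sInf {D : ℕ∞ | HasDepthAtMost G w D}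

/-- The iterational depth `s(G)`: the supremum of `s(w, G)` over all iterated identities `w` of `G`,
in any number of letters, that are non-trivial elements of the free group. It is `⊥` (that is, `-∞`)
if there are none, and `⊤` (that is, `+∞`) if the depths `s(w, G)` have no common finite bound. -/
noncomputable def iterationalDepth (G : Type*) [Group G] : WithBot ℕ∞ :=
  sSup {s : WithBot ℕ∞ | ∃ (n : ℕ) (w : FreeGroup (Fin (n + 1))),
    w ≠ 1 ∧ IsIteratedIdentity G w ∧ s = (wordDepth G w : WithBot ℕ∞)}

/-- `G` is bounded: `s(G)` is finite, that is, `1 ≤ s(G) < ∞`. -/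
def IsBoundedGroup (G : Type*) [Group G] : Prop :=
  1 ≤ iterationalDepth G ∧ iterationalDepth G < ⊤

/-- `G` is metabelian: it has an abelian normal subgroup with abelian quotient. -/
def IsMetabelian (G : Type*) [Group G] : Prop :=
  ∃ (N : Subgroup G) (_ : N.Normal),
    (∀ a ∈ N, ∀ b ∈ N, a * b = b * a) ∧ ∀ a b : G ⧸ N, a * b = b * a

/-! The commutator subgroup `M` of `G` is a finitely generated module over the integral group ring
of the abelianization, a Noetherian ring, and a word acts affinely in its first letter on each coset
of `M`. If 1 has period `p` under the induced map of the quotient, the `p`-th iterate on `M` is some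
`m ↦ P • m + v` all of whose orbits hit 0. These orbits enter the largest finite submodule `T` after
a number of steps independent of `P` and `v`, and then hit 0 within `|T|` steps
(`exists_uniform_bound_affine`).

`ConjActsByScalars.exists_hasUniformDepth` thus lifts a depth bound from a quotient. It is applied
to the abelianization over the trivial group, then to `G` over its abelianization. -/

/-- A Noetherian module has a largest finite submodule. -/
theorem exists_largest_finite_submodule (R M : Type*) [CommRing R] [AddCommGroup M] [Module R M]
    [IsNoetherian R M] :
    ∃ T : Submodule R M, Finite T ∧ ∀ F : Submodule R M, Finite F → F ≤ T := by
  obtain ⟨T, hT, hmax⟩ := WellFounded.has_min (wellFounded_gt (α := Submodule R M))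
    {F : Submodule R M | Finite F} ⟨⊥, by simpa using (inferInstance : Finite (⊥ : Submodule R M))⟩
  have hT : Finite T := hT
  refine ⟨T, hT, fun F hF => ?_⟩
  have hfin : Finite (F ⊔ T : Submodule R M) := by
    have hset : ((F ⊔ T : Submodule R M) : Set M).Finite := by
      rw [Submodule.coe_sup]
      exact Set.Finite.add (Set.toFinite (F : Set M)) (Set.toFinite (T : Set M))
    exact hset
  have h := hmax (F ⊔ T) hfin
  by_contra hle
  exact h (lt_of_le_of_ne le_sup_right fun h' => hle (h' ▸ le_sup_left))

/-- An orbit that stays in a finite set and hits a point hits it within the size of the set. -/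
theorem exists_iterate_eq_le_card {α : Type*} (f : α → α) (T : Set α) [Finite T]
    (hfT : ∀ a ∈ T, f a ∈ T) {a b : α} (ha : a ∈ T) (h : ∃ d, 1 ≤ d ∧ f^[d] a = b) :
    ∃ d, 1 ≤ d ∧ d ≤ Nat.card T ∧ f^[d] a = b := by
  classical
  set d := Nat.find h with hd
  obtain ⟨hd1, hdb⟩ := Nat.find_spec h
  refine ⟨d, hd1, ?_, hdb⟩
  have hmem : ∀ i, f^[i] a ∈ T := fun i => by
    induction i with
    | zero => exact ha
    | succ i ih => rw [Function.iterate_succ_apply']; exact hfT _ ih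
  have key : ∀ i j : ℕ, i < j → j < d → f^[i] a ≠ f^[j] a := by
    intro i j hij hjd heq
    have h1 : f^[(d - j) + i] a = b := by
      rw [Function.iterate_add_apply, heq, ← Function.iterate_add_apply, Nat.sub_add_cancel hjd.le]
      exact hdb
    exact Nat.find_min h (m := (d - j) + i) (by omega) ⟨by omega, h1⟩
  have hinj : Function.Injective (fun i : Fin d => (⟨f^[i] a, hmem i⟩ : T)) := by
    intro i j hij
    have hij : f^[i] a = f^[j] a := congrArg Subtype.val hij
    rcases lt_trichotomy i j with hlt | heq | hlt
    · exact absurd hij (key i j hlt j.2)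
    · exact heq
    · exact absurd hij.symm (key j i hlt i.2)
  simpa using Nat.card_le_card_of_injective _ hinj

/-! ### Affine self-maps of Noetherian modules. -/

section Affine

variable {R M : Type*} [CommRing R] [AddCommGroup M] [Module R M]

theorem iterate_affine (P : R) (v : M) (d : ℕ) (m : M) :
    (fun m => P • m + v)^[d] m = P ^ d • m + (fun m => P • m + v)^[d] 0 := by
  induction d with
  | zero => simp
  | succ d ih =>
    rw [Function.iterate_succ_apply', Function.iterate_succ_apply', ih]
    simp only [smul_add, smul_smul, pow_succ']
    abel

/-- If all orbits of `m ↦ P • m + v` hit `0`, then they stay, up to powers of `P`, in a finite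
submodule. -/
theorem exists_finite_submodule_of_affine (P : R) (v : M)
    (h : ∀ m, ∃ d, 1 ≤ d ∧ (fun m => P • m + v)^[d] m = 0) :
    ∃ F : Submodule R M, Finite F ∧ v ∈ F ∧ ∀ m, ∃ d, P ^ d • m ∈ F := by
  set f : M → M := fun m => P • m + v with hf
  obtain ⟨p, hp1, hp⟩ := h 0
  have hper : Function.IsPeriodicPt f p 0 := hp
  have horb : ∀ i, f^[i] 0 ∈ (fun i => f^[i] 0) '' Set.Iio p := fun i =>
    ⟨i % p, Nat.mod_lt _ hp1, hper.iterate_mod_apply i⟩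
  -- Since 0 has period `p`, `f^[p]` is multiplication by `P ^ p`; `F` is its fixed submodule. It
  -- contains the orbit of 0, and equals it because powers of `P ^ p` send every point into that
  -- orbit.
  let F : Submodule R M := LinearMap.ker (LinearMap.lsmul R M (P ^ p - 1))
  have memF : ∀ m, m ∈ F ↔ P ^ p • m = m := fun m => by
    simp [F, sub_eq_zero]
  have hpP : ∀ m, f^[p] m = P ^ p • m := fun m => by
    rw [iterate_affine, ← hf, hp, add_zero]
  have horbF : ∀ i, f^[i] 0 ∈ F := fun i => by
    rw [memF, ← hpP, ← Function.iterate_add_apply, add_comm, Function.iterate_add_apply, hp]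
  have hpow : ∀ m, ∃ j i, P ^ (p * j) • m = f^[i] 0 := fun m => by
    obtain ⟨d, hd1, hd⟩ := h m
    -- Once `d` steps have reached 0, the rest of the `p * d` steps follow the orbit of 0.
    refine ⟨d, p * d - d, ?_⟩
    have h1 : f^[p * d] 0 = 0 := (hper.mul_const d)
    have h2 := iterate_affine P v (p * d) m
    rw [← hf, h1, add_zero] at h2
    rw [← h2, ← hd, ← Function.iterate_add_apply,
      Nat.sub_add_cancel (Nat.le_mul_of_pos_left d hp1)]
  refine ⟨F, ?_, ?_, fun m => ?_⟩
  · refine Set.Finite.subset ((Set.finite_Iio p).image fun i => f^[i] 0) fun m hm => ?_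
    obtain ⟨j, i, hji⟩ := hpow m
    have : P ^ (p * j) • m = m := by
      clear hji
      induction j with
      | zero => simp
      | succ j ih => rw [Nat.mul_succ, pow_add, mul_smul, (memF m).1 hm, ih]
    rw [← this, hji]
    exact horb i
  · simpa [hf] using horbF 1
  · obtain ⟨j, i, hji⟩ := hpow m
    exact ⟨p * j, hji ▸ horbF i⟩

/-- In a Noetherian module there is a uniform bound on the hitting times of `0` for all affine maps
`m ↦ P • m + v` whose orbits all hit `0`. -/
theorem exists_uniform_bound_affine (R M : Type*) [CommRing R] [IsNoetherianRing R]
    [AddCommGroup M] [Module R M] [Module.Finite R M] :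
    ∃ D : ℕ, ∀ (P : R) (v : M), (∀ m, ∃ d, 1 ≤ d ∧ (fun m => P • m + v)^[d] m = 0) →
      ∀ m, ∃ d, 1 ≤ d ∧ d ≤ D ∧ (fun m => P • m + v)^[d] m = 0 := by
  obtain ⟨T, hTfin, hT⟩ := exists_largest_finite_submodule R M
  let I : Ideal R := T.colon Set.univ
  have memI : ∀ r, r ∈ I ↔ ∀ m : M, r • m ∈ T := fun r => by
    simp [I, Submodule.mem_colon]
  -- One exponent `k` serves every `P` in the radical.
  obtain ⟨k, hk⟩ := I.exists_radical_pow_le_of_fg (IsNoetherian.noetherian _)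
  refine ⟨k + Nat.card T, fun P v h m => ?_⟩
  obtain ⟨F, hF, hvF, hPF⟩ := exists_finite_submodule_of_affine P v h
  have hv : v ∈ T := hT F hF hvF
  have hP : ∀ m, ∃ d, P ^ d • m ∈ T := fun m => (hPF m).imp fun d hd => hT F hF hd
  have hrad : P ∈ I.radical := by
    obtain ⟨s, hs⟩ := Module.Finite.fg_top (R := R) (M := M)
    choose e he using hP
    refine ⟨s.sup e, (memI _).2 fun m => ?_⟩
    have hm : m ∈ Submodule.span R (s : Set M) := hs ▸ Submodule.mem_top
    induction hm using Submodule.span_induction with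
    | mem y hy =>
      rw [← Nat.sub_add_cancel (Finset.le_sup (f := e) hy), pow_add, mul_smul]
      exact T.smul_mem _ (he y)
    | zero => simp
    | add y z _ _ hy hz => rw [smul_add]; exact T.add_mem hy hz
    | smul r y _ hy => rw [smul_comm]; exact T.smul_mem _ hy
  have hPk : ∀ m : M, P ^ k • m ∈ T := (memI _).1 (hk (Ideal.pow_mem_pow hrad k))
  have hfT : ∀ a ∈ (T : Set M), P • a + v ∈ (T : Set M) := fun a ha =>
    T.add_mem (T.smul_mem _ ha) hv
  have hmem : (fun m => P • m + v)^[k] m ∈ (T : Set M) := by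
    rw [iterate_affine]
    refine T.add_mem (hPk m) ?_
    generalize k = i
    induction i with
    | zero => exact T.zero_mem
    | succ i ih => rw [Function.iterate_succ_apply']; exact hfT _ ih
  have : Finite (T : Set M) := hTfin
  obtain ⟨d, hd1, hd2, hd⟩ := exists_iterate_eq_le_card (fun m => P • m + v) (T : Set M) hfT hmem
    (h _)
  refine ⟨d + k, by omega, ?_, ?_⟩
  · rw [add_comm]; exact Nat.add_le_add_left hd2 k
  · rw [Function.iterate_add_apply, hd]

end Affine

open scoped commutatorElement

/-! ### Words as self-maps, and extensions by modules. -/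

section Words

variable {G H : Type*} [Group G] [Group H] {n : ℕ}

theorem map_verbalMap (f : G →* H) (w : FreeGroup (Fin (n + 1))) (x : Fin (n + 1) → G) (g : G) :
    f (verbalMap w x g) = verbalMap w (f ∘ x) (f g) := by
  have : f.comp (FreeGroup.lift (Function.update x 0 g)) =
      FreeGroup.lift (Function.update (f ∘ x) 0 (f g)) := by
    ext i
    simp [← Function.comp_update]
  exact DFunLike.congr_fun this w

theorem semiconj_verbalMap (f : G →* H) (w : FreeGroup (Fin (n + 1))) (x : Fin (n + 1) → G) :
    Function.Semiconj f (verbalMap w x) (verbalMap w (f ∘ x)) :=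
  map_verbalMap f w x

theorem map_engelIter (f : G →* H) (w : FreeGroup (Fin (n + 1))) (d : ℕ) (x : Fin (n + 1) → G) :
    f (engelIter w d x) = engelIter w d (f ∘ x) :=
  (semiconj_verbalMap f w x).iterate_right d (x 0)

theorem IsIteratedIdentity.of_surjective {f : G →* H} (hf : Function.Surjective f)
    {w : FreeGroup (Fin (n + 1))} (h : IsIteratedIdentity G w) : IsIteratedIdentity H w := by
  intro y
  choose x hx using fun i => hf (y i)
  obtain ⟨d, hd1, hd⟩ := h x
  refine ⟨d, hd1, ?_⟩
  rw [← map_one f, ← hd, map_engelIter]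
  exact congrArg _ (funext fun i => (hx i).symm)

/-- `verbalMap` ignores `x 0`, so the starting point can vary while the map stays fixed. -/
theorem engelIter_update (w : FreeGroup (Fin (n + 1))) (d : ℕ) (x : Fin (n + 1) → G) (g : G) :
    engelIter w d (Function.update x 0 g) = (verbalMap w x)^[d] g := by
  have : verbalMap w (Function.update x 0 g) = verbalMap w x := by
    funext a
    simp [verbalMap]
  simp [engelIter, this]

theorem IsIteratedIdentity.exists_iterate_eq_one {w : FreeGroup (Fin (n + 1))}
    (h : IsIteratedIdentity G w) (x : Fin (n + 1) → G) (g : G) :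
    ∃ d, 1 ≤ d ∧ (verbalMap w x)^[d] g = 1 := by
  simpa only [engelIter_update] using h (Function.update x 0 g)

variable {R M : Type*} [CommRing R] [AddCommGroup M] [Module R M]

/-- Conjugation by each element of `G` acts on the image of `ι` as a scalar of `R`. -/
def ConjActsByScalars (R : Type*) {M G : Type*} [Group G] [CommRing R] [AddCommGroup M]
    [Module R M] (ι : Multiplicative M →* G) : Prop :=
  ∀ g : G, ∃ r : R, ∀ m : M, g * ι (.ofAdd m) * g⁻¹ = ι (.ofAdd (r • m))

/-- Words act affinely on each coset of a normal subgroup carrying a module structure. -/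
theorem ConjActsByScalars.exists_verbalMap_mul {ι : Multiplicative M →* G}
    (hι : ConjActsByScalars R ι) (w : FreeGroup (Fin (n + 1))) (x : Fin (n + 1) → G) (g : G) :
    ∃ P : R, ∀ m : M, verbalMap w x (g * ι (.ofAdd m)) =
      verbalMap w x g * ι (.ofAdd (P • m)) := by
  unfold verbalMap
  induction w using FreeGroup.induction_on with
  | C1 => exact ⟨0, fun m => by simp⟩
  | of i =>
    rcases eq_or_ne i 0 with rfl | hi
    · exact ⟨1, fun m => by simp⟩
    · exact ⟨0, fun m => by simp [hi]⟩
  | inv_of i ih =>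
    obtain ⟨P, hP⟩ := ih
    obtain ⟨r, hr⟩ := hι (FreeGroup.lift (Function.update x 0 g) (FreeGroup.of i))
    refine ⟨-(r * P), fun m => ?_⟩
    rw [map_inv, map_inv, hP, neg_smul, ofAdd_neg, map_inv, mul_smul, ← hr]
    group
  | mul u v hu hv =>
    obtain ⟨P, hP⟩ := hu
    obtain ⟨Q, hQ⟩ := hv
    obtain ⟨r, hr⟩ := hι (FreeGroup.lift (Function.update x 0 g) v)⁻¹
    -- Moving the `P • m` term past the value of `v` conjugates it: the product rule of Fox
    -- calculus.
    refine ⟨r * P + Q, fun m => ?_⟩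
    rw [map_mul, map_mul, hP, hQ, add_smul, ofAdd_add, map_mul, mul_smul, ← hr]
    group

theorem ConjActsByScalars.exists_iterate_verbalMap_mul {ι : Multiplicative M →* G}
    (hι : ConjActsByScalars R ι) (w : FreeGroup (Fin (n + 1))) (x : Fin (n + 1) → G) (d : ℕ)
    (g : G) :
    ∃ P : R, ∀ m : M, (verbalMap w x)^[d] (g * ι (.ofAdd m)) =
      (verbalMap w x)^[d] g * ι (.ofAdd (P • m)) := by
  induction d with
  | zero => exact ⟨1, fun m => by simp⟩
  | succ d ih =>
    obtain ⟨P, hP⟩ := ih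
    obtain ⟨Q, hQ⟩ := hι.exists_verbalMap_mul w x ((verbalMap w x)^[d] g)
    refine ⟨Q * P, fun m => ?_⟩
    rw [Function.iterate_succ_apply', Function.iterate_succ_apply', hP, hQ, mul_smul]

/-- All hitting times of `1` for iterated identities of `G` are at most `D`. -/
def HasUniformDepth (G : Type*) [Group G] (D : ℕ) : Prop :=
  ∀ (n : ℕ) (w : FreeGroup (Fin (n + 1))), IsIteratedIdentity G w → HasDepthAtMost G w D

/-- A uniform bound on depths passes to extensions by normal subgroups that are finitely generated
modules over a Noetherian ring through which conjugation acts. -/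
theorem ConjActsByScalars.exists_hasUniformDepth [IsNoetherianRing R] [Module.Finite R M]
    {ι : Multiplicative M →* G} (hι : ConjActsByScalars R ι) (hinj : Function.Injective ι)
    {f : G →* H} (hf : Function.Surjective f) (hker : f.ker = ι.range) {D : ℕ}
    (hD : HasUniformDepth H D) : ∃ D', HasUniformDepth G D' := by
  obtain ⟨E, hE⟩ := exists_uniform_bound_affine R M
  -- At most `D` steps reach the kernel; then at most `E` rounds of `p ≤ D` steps reach 1.
  refine ⟨D + D * E, fun n w hw x => ?_⟩
  set φ := verbalMap w x with hφ
  set φ' := verbalMap w (f ∘ x) with hφ'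
  have hsemi : ∀ d g, f (φ^[d] g) = φ'^[d] (f g) := fun d g =>
    (semiconj_verbalMap f w x).iterate_right d g
  have hbound : ∀ g, ∃ d, 1 ≤ d ∧ d ≤ D ∧ φ'^[d] (f g) = 1 := fun g => by
    obtain ⟨d, h1, h2, h3⟩ := hD n w (hw.of_surjective hf) (Function.update (f ∘ x) 0 (f g))
    exact ⟨d, h1, by exact_mod_cast h2, by rwa [engelIter_update] at h3⟩
  have mem_range : ∀ g, f g = 1 → ∃ m : M, ι (.ofAdd m) = g := fun g hg => by
    obtain ⟨m, hm⟩ : g ∈ ι.range := hker ▸ hg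
    exact ⟨m.toAdd, hm⟩
  have map_range : ∀ m : M, f (ι (.ofAdd m)) = 1 := fun m => by
    have : ι (.ofAdd m) ∈ f.ker := hker ▸ ⟨_, rfl⟩
    exact this
  -- As 1 is periodic, `p` is positive, and orbits starting in the kernel return to it exactly at
  -- multiples of `p`.
  set p := Function.minimalPeriod φ' 1 with hp
  have hpD : p ≤ D := by
    obtain ⟨d, h1, h2, h3⟩ := hbound 1
    rw [map_one] at h3
    exact (Function.IsPeriodicPt.minimalPeriod_le h1 h3).trans h2
  have hper : φ'^[p] 1 = 1 := Function.isPeriodicPt_minimalPeriod φ' 1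
  obtain ⟨v, hv⟩ := mem_range (φ^[p] 1) (by rw [hsemi, map_one, hper])
  obtain ⟨P, hP⟩ := hι.exists_iterate_verbalMap_mul w x p 1
  have hψ : ∀ m, φ^[p] (ι (.ofAdd m)) = ι (.ofAdd (P • m + v)) := fun m => by
    rw [add_comm, ofAdd_add, map_mul, hv, ← hP, one_mul]
  have hψ' : ∀ e m, φ^[p * e] (ι (.ofAdd m)) = ι (.ofAdd ((fun m => P • m + v)^[e] m)) :=
    fun e => by
      induction e with
      | zero => simp
      | succ e ih =>
        intro m
        rw [Nat.mul_succ, Function.iterate_add_apply, hψ, ih, Function.iterate_succ_apply]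
  have hone : ∀ m : M, ι (.ofAdd m) = 1 ↔ m = 0 := fun m => by
    rw [← map_one ι, hinj.eq_iff, ofAdd_eq_one]
  have hall : ∀ m, ∃ e, 1 ≤ e ∧ (fun m => P • m + v)^[e] m = 0 := fun m => by
    obtain ⟨d, hd1, hd⟩ := hw.exists_iterate_eq_one x (ι (.ofAdd m))
    have hd' : φ'^[d] 1 = 1 := by
      have h1 := hsemi d (ι (.ofAdd m))
      rwa [map_range, hd, map_one, eq_comm] at h1
    obtain ⟨e, rfl⟩ : p ∣ d := Function.IsPeriodicPt.minimalPeriod_dvd hd'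
    refine ⟨e, Nat.pos_of_ne_zero ?_, ?_⟩
    · rintro rfl
      simp at hd1
    · rwa [← hφ, hψ', hone] at hd
  obtain ⟨d, hd1, hd2, hd⟩ := hbound (x 0)
  obtain ⟨m, hm⟩ := mem_range (φ^[d] (x 0)) (by rw [hsemi, hd])
  obtain ⟨e, he1, he2, he⟩ := hE P v hall m
  refine ⟨p * e + d, by omega, ?_, ?_⟩
  · have : p * e ≤ D * E := Nat.mul_le_mul hpD he2
    exact_mod_cast (by omega : p * e + d ≤ D + D * E)
  · rw [engelIter, ← hφ, Function.iterate_add_apply, ← hm, hψ', he, ofAdd_zero, map_one]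

end Words

/-! ### Abelian groups, and generation of the commutator subgroup. -/

theorem hasUniformDepth_of_subsingleton (G : Type*) [Group G] [Subsingleton G] :
    HasUniformDepth G 1 :=
  fun _ _ _ _ => ⟨1, le_rfl, by simp, Subsingleton.elim _ _⟩

theorem exists_hasUniformDepth_of_commGroup (A : Type*) [CommGroup A] [Group.FG A] :
    ∃ D, HasUniformDepth A D := by
  have : Module.Finite ℤ (Additive A) := Module.Finite.iff_addGroup_fg.2 inferInstance
  let ι : Multiplicative (Additive A) →* A := MonoidHom.id A
  have hι : ConjActsByScalars ℤ ι := fun g => ⟨1, fun m => by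
    rw [mul_inv_cancel_comm, one_smul]⟩
  refine hι.exists_hasUniformDepth (f := (1 : A →* Unit)) Function.injective_id
    (fun u => ⟨1, Subsingleton.elim _ _⟩) ?_ (hasUniformDepth_of_subsingleton Unit)
  ext a
  exact ⟨fun _ => ⟨a, rfl⟩, fun _ => rfl⟩

/-- If a set generates `G` and a normal subgroup contains the commutators of all pairs of generators
then it contains the commutator subgroup. -/
theorem commutator_le_of_closure_eq_top {G : Type*} [Group G] {S : Set G}
    (hS : Subgroup.closure S = ⊤) (K : Subgroup G) [K.Normal]
    (h : ∀ s ∈ S, ∀ t ∈ S, ⁅s, t⁆ ∈ K) : commutator G ≤ K := by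
  have hcomm : ∀ a b : G ⧸ K, a ∈ QuotientGroup.mk' K '' S → b ∈ QuotientGroup.mk' K '' S →
      a * b = b * a := by
    rintro _ _ ⟨s, hs, rfl⟩ ⟨t, ht, rfl⟩
    rw [← commutatorElement_eq_one_iff_mul_comm, ← map_commutatorElement]
    exact (QuotientGroup.eq_one_iff _).2 (h s hs t ht)
  have htop : Subgroup.closure (QuotientGroup.mk' K '' S) = ⊤ := by
    rw [← MonoidHom.map_closure, hS, ← MonoidHom.range_eq_map, QuotientGroup.range_mk']
  -- Everything centralizes the generators (`hle`), and everything commutes with whatever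
  -- centralizes them (`hcent`).
  have hcent := Subgroup.closure_le_centralizer_centralizer (QuotientGroup.mk' K '' S)
  have hle : Subgroup.closure (QuotientGroup.mk' K '' S) ≤
      Subgroup.centralizer (QuotientGroup.mk' K '' S) := by
    rw [Subgroup.closure_le]
    intro a ha
    exact Subgroup.mem_centralizer_iff.2 fun b hb => hcomm b a hb ha
  rw [htop] at hcent hle
  rw [commutator_def, Subgroup.commutator_le]
  intro a _ b _
  rw [← QuotientGroup.eq_one_iff]
  change QuotientGroup.mk' K ⁅a, b⁆ = 1
  rw [map_commutatorElement, commutatorElement_eq_one_iff_mul_comm]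
  exact Subgroup.mem_centralizer_iff.1 (hcent (Subgroup.mem_top (QuotientGroup.mk' K b))) _
    (hle (Subgroup.mem_top _))

/-! ### The commutator subgroup as a module. -/

section Metabelian

variable {G : Type*} [Group G]

theorem IsMetabelian.isMulCommutative_commutator (h : IsMetabelian G) :
    IsMulCommutative (commutator G) := by
  obtain ⟨N, hN, hab, hquot⟩ := h
  have hle : commutator G ≤ N :=
    commutator_le_of_closure_eq_top (S := Set.univ) Subgroup.closure_univ N fun s _ t _ => by
      rw [← QuotientGroup.eq_one_iff]
      change QuotientGroup.mk' N ⁅s, t⁆ = 1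
      rw [map_commutatorElement, commutatorElement_eq_one_iff_mul_comm]
      exact hquot _ _
  exact ⟨⟨fun a b => Subtype.ext (hab a (hle a.2) b (hle b.2))⟩⟩

open scoped IsMulCommutative

/-- The conjugation action of `G` on its commutator subgroup, as a representation. -/
def conjRep (G : Type*) [Group G] [IsMulCommutative (commutator G)] :
    G →* Module.End ℤ (Additive (commutator G)) where
  toFun g := (MulAut.conjNormal g).toMonoidHom.toAdditive.toIntLinearMap
  map_one' := by ext; simp
  map_mul' g h := by ext; simp

/-- This lets the action descend to the abelianization, whose group ring is commutative. -/
theorem conjRep_eq_one [IsMulCommutative (commutator G)] {g : G} (hg : g ∈ commutator G) :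
    conjRep G g = 1 := by
  ext m
  have : (⟨g, hg⟩ : commutator G) * m.toMul = m.toMul * ⟨g, hg⟩ := mul_comm _ _
  have := congrArg Subtype.val this
  simpa [conjRep, mul_inv_eq_iff_eq_mul] using this

/-- The conjugation action on the commutator subgroup, extended to the integral group ring of the
abelianization. -/
noncomputable def conjAlgHom (G : Type*) [Group G] [IsMulCommutative (commutator G)] :
    MonoidAlgebra ℤ (Abelianization G) →ₐ[ℤ] Module.End ℤ (Additive (commutator G)) :=
  MonoidAlgebra.lift ℤ _ _
    (QuotientGroup.lift (commutator G) (conjRep G) fun _ hg =>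
      MonoidHom.mem_ker.2 (conjRep_eq_one hg) : Abelianization G →* _)

theorem conjAlgHom_of [IsMulCommutative (commutator G)] (g : G) :
    conjAlgHom G (MonoidAlgebra.of ℤ (Abelianization G) (Abelianization.of g)) = conjRep G g :=
  MonoidAlgebra.lift_of _ _

/-- The commutator subgroup as a module over the integral group ring of the abelianization. -/
noncomputable abbrev commutatorModule (G : Type*) [Group G] [IsMulCommutative (commutator G)] :
    Module (MonoidAlgebra ℤ (Abelianization G)) (Additive (commutator G)) :=
  Module.compHom _ (conjAlgHom G).toRingHom

attribute [local instance] commutatorModule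

theorem of_smul_commutator [IsMulCommutative (commutator G)] (g : G)
    (m : Additive (commutator G)) :
    ((MonoidAlgebra.of ℤ (Abelianization G) (Abelianization.of g) • m).toMul : G) =
      g * m.toMul * g⁻¹ :=
  congrArg (fun r : Module.End ℤ (Additive (commutator G)) => ((r m).toMul : G)) (conjAlgHom_of g)

/-- The inclusion of the commutator subgroup, written multiplicatively. -/
abbrev commutatorInclusion (G : Type*) [Group G] [IsMulCommutative (commutator G)] :
    Multiplicative (Additive (commutator G)) →* G :=
  (commutator G).subtype

theorem conjActsByScalars_commutatorInclusion [IsMulCommutative (commutator G)] :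
    ConjActsByScalars (MonoidAlgebra ℤ (Abelianization G)) (commutatorInclusion G) :=
  fun g => ⟨.of ℤ _ (Abelianization.of g), fun m => (of_smul_commutator g m).symm⟩

/-- Commutators of pairs of generators span: scalars include conjugations, so their span is normal
in `G`. -/
theorem finite_commutatorModule [IsMulCommutative (commutator G)] [Group.FG G] :
    Module.Finite (MonoidAlgebra ℤ (Abelianization G)) (Additive (commutator G)) := by
  obtain ⟨S, hS⟩ := Group.FG.out (G := G)
  let c : G × G → Additive (commutator G) := fun s =>
    .ofMul ⟨⁅s.1, s.2⁆, Subgroup.commutator_mem_commutator (Subgroup.mem_top _) (Subgroup.mem_top _)⟩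
  let V := Submodule.span (MonoidAlgebra ℤ (Abelianization G)) (c '' (S ×ˢ S : Set (G × G)))
  let K : Subgroup G := V.toAddSubgroup.toSubgroup'.map (commutator G).subtype
  have memK : ∀ m : Additive (commutator G), (m.toMul : G) ∈ K ↔ m ∈ V := fun m => by
    constructor
    · rintro ⟨m', hm', h⟩
      have : m' = m.toMul := Subtype.ext h
      subst this
      exact hm'
    · exact fun hm => ⟨m.toMul, hm, rfl⟩
  have hKn : K.Normal := ⟨by
    rintro _ ⟨m, hm, rfl⟩ g
    have := (memK _).2 (V.smul_mem (.of ℤ _ (Abelianization.of g)) (x := .ofMul m) hm)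
    exact of_smul_commutator g (.ofMul m) ▸ this⟩
  have hle : commutator G ≤ K := commutator_le_of_closure_eq_top hS K fun s hs t ht =>
    (memK (c (s, t))).2 (Submodule.subset_span ⟨(s, t), ⟨hs, ht⟩, rfl⟩)
  refine ⟨Submodule.fg_def.2 ⟨_, (S.finite_toSet.prod S.finite_toSet).image c, ?_⟩⟩
  exact (Submodule.eq_top_iff').2 fun m => (memK m).1 (hle m.toMul.2)

/-- The group ring is a finitely generated commutative ring, hence Noetherian by Hilbert's basis
theorem. -/
theorem IsMetabelian.exists_hasUniformDepth [Group.FG G] (h : IsMetabelian G) :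
    ∃ D, HasUniformDepth G D := by
  have := h.isMulCommutative_commutator
  have : Group.FG (Abelianization G) :=
    Group.fg_of_surjective (f := Abelianization.of) QuotientGroup.mk_surjective
  have : Monoid.FG (Abelianization G) := Group.fg_iff_monoid_fg.1 inferInstance
  have : IsNoetherianRing (MonoidAlgebra ℤ (Abelianization G)) :=
    Algebra.FiniteType.isNoetherianRing ℤ _
  have := finite_commutatorModule (G := G)
  obtain ⟨D, hD⟩ := exists_hasUniformDepth_of_commGroup (Abelianization G)
  refine conjActsByScalars_commutatorInclusion.exists_hasUniformDepth Subtype.val_injective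
    (f := Abelianization.of) QuotientGroup.mk_surjective ?_ hD
  rw [Abelianization.ker_of]
  exact (Subgroup.range_subtype _).symm

end Metabelian

/-! ### A non-trivial identity, and the conclusion. -/

/-- The word `[[x₀, x₁], [x₂, x₃]]`, whose values are trivial in metabelian groups. -/
def metabelianWord : FreeGroup (Fin (3 + 1)) :=
  ⁅⁅FreeGroup.of (0 : Fin 4), FreeGroup.of (1 : Fin 4)⁆, ⁅FreeGroup.of (2 : Fin 4), FreeGroup.of (3 : Fin 4)⁆⁆

theorem metabelianWord_ne_one : metabelianWord ≠ 1 := by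
  unfold metabelianWord
  -- Equality in the free group is decided on reduced words.
  decide

theorem IsMetabelian.isIteratedIdentity {G : Type*} [Group G] (h : IsMetabelian G) :
    IsIteratedIdentity G metabelianWord := by
  have := h.isMulCommutative_commutator
  intro x
  refine ⟨1, le_rfl, ?_⟩
  have hmem : ∀ a b : G, ⁅a, b⁆ ∈ commutator G := fun a b =>
    Subgroup.commutator_mem_commutator (Subgroup.mem_top _) (Subgroup.mem_top _)
  have hcomm : ∀ a b c d : G, ⁅⁅a, b⁆, ⁅c, d⁆⁆ = 1 := fun a b c d => by
    rw [commutatorElement_eq_one_iff_mul_comm]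
    exact congrArg Subtype.val (mul_comm' (⟨_, hmem a b⟩ : commutator G) ⟨_, hmem c d⟩)
  simp only [engelIter, verbalMap, metabelianWord, Function.iterate_one, map_commutatorElement,
    hcomm]

theorem one_le_wordDepth (G : Type*) [Group G] {n : ℕ} (w : FreeGroup (Fin (n + 1))) :
    1 ≤ wordDepth G w := by
  refine le_sInf fun D hD => ?_
  obtain ⟨d, hd1, hd2, -⟩ := hD 1
  exact le_trans (by exact_mod_cast hd1) hd2

theorem theorem6p1 (G : Type*) [Group G] (hfg : Group.FG G) (hmet : IsMetabelian G) :
    IsBoundedGroup G := by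
  obtain ⟨D, hD⟩ := hmet.exists_hasUniformDepth
  constructor
  · refine le_trans ?_ (le_sSup ⟨3, metabelianWord, metabelianWord_ne_one, hmet.isIteratedIdentity,
      rfl⟩)
    exact_mod_cast one_le_wordDepth G metabelianWord
  · refine lt_of_le_of_lt (b := ((D : ℕ∞) : WithBot ℕ∞)) (sSup_le ?_) ?_
    · rintro _ ⟨n, w, -, hw, rfl⟩
      exact_mod_cast (sInf_le (hD n w hw) : wordDepth G w ≤ D)
    · exact WithBot.coe_lt_coe.2 (ENat.natCast_lt_top D)
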